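/- Let $\mathbb{F}$ be a field and let $r\ge 2$, $s\ge 2$ be integers. For an integer $A\ge 0$, call a collection $(H_i)_{i\in I}$ of linear subspaces of $\mathbb{F}^{m}$, each of rank (linear dimension) $r$, an *$r$-uniform strong $(s,A)$ subspace design* in $\mathbb{F}^m$ if $\sum_{i\in I}\operatorname{rank}(H_i\cap W)\le A$ for every linear subspace $W\le\mathbb{F}^m$ of rank $s$ (the index set $I$ may be infinite). 1. If $\mathbb{F}$ has more than $r+s$ elements, then there exists an $r$-uniform strong $\left(s,\ rs+\min\left\{\binom{s}{2},\binom{r}{2}\right\}\right)$ subspace design in $\mathbb{F}^{r+s}$ consisting of pairwise distinct subspaces $H_t$, one for each $t\in\mathbb{F}$ (so it has $|\mathbb{F}|$ members). 2. If the characteristic of $\mathbb{F}$ is bigger than $r+s$, or is $0$, then there exists an $r$-uniform strong $(s,\ rs)$ subspace design in $\mathbb{F}^{r+s}$ consisting of pairwise distinct subspaces $H_t$, one for each $t\in\mathbb{F}$. -/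

import Mathlib

/-- An `r`-uniform strong `(s, A)` subspace design in the vector space `F ^ m`: a collection
`(H i)` of linear subspaces, each of rank `r`, such that for every linear subspace `W` of rank `s`
the sum over all `i` of `rank (H i ∩ W)` is at most `A`.

The index type may be infinite. As the summands are natural numbers, the sum over all indices
is at most `A` exactly when every finite partial sum is at most `A`; for a finite index type this
is the same as bounding the full sum. -/
structure IsUniformStrongSubspaceDesign {F : Type*} [Field F] {m : ℕ} {ι : Type*}
    (r s A : ℕ) (H : ι → Submodule F (Fin m → F)) : Prop where
  rank_eq : ∀ i : ι, Module.finrank F (H i) = r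
  sum_rank_le : ∀ W : Submodule F (Fin m → F), Module.finrank F W = s →
    ∀ T : Finset ι, ∑ i ∈ T, Module.finrank F (H i ⊓ W : Submodule F (Fin m → F)) ≤ A

/-- For a finite collection the bound is the bound on the full sum. -/
theorem isUniformStrongSubspaceDesign_iff_of_fintype {F : Type*} [Field F] {m : ℕ} {ι : Type*}
    [Fintype ι] (r s A : ℕ) (H : ι → Submodule F (Fin m → F)) :
    IsUniformStrongSubspaceDesign r s A H ↔
      (∀ i : ι, Module.finrank F (H i) = r) ∧
      ∀ W : Submodule F (Fin m → F), Module.finrank F W = s →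
        ∑ i, Module.finrank F (H i ⊓ W : Submodule F (Fin m → F)) ≤ A :=
  ⟨fun h => ⟨h.rank_eq, fun W hW => h.sum_rank_le W hW Finset.univ⟩,
   fun h => ⟨h.1, fun W hW T =>
    (Finset.sum_le_sum_of_subset (Finset.subset_univ T)).trans (h.2 W hW)⟩⟩

/-! Identify F^(r+s) with the polynomials of degree below r + s, and let H_t be the multiples of g_t
= ∏_{k<s} (X - a_k t). Given W, take f_1, ..., f_s in W of distinct degrees and P = det (D_j f_i),
where the operators D_j send multiples of g_t to multiples of X - t. Elements of H_t ∩ W give kernel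
vectors of the matrix at X = t, so (X - t)^rank(H_t ∩ W) divides P (`pow_finrank_dvd_det`), and the
ranks sum to at most deg P.

Taking a_k = γ^k, D_j f = f(γ^j X) gives deg P ≤ rs + C(s,2). Taking a_k = 1 and D_j the j-th
derivative saves C(s,2). In both cases P ≠ 0 by a Vandermonde determinant in the degrees. Duality
exchanges r and s, which gives the minimum. -/

open Polynomial Module

/-! ### Linear algebra of polynomial spaces and matrices -/

/-- A space of polynomials of dimension `s` contains `s` nonzero polynomials of pairwise distinct
degrees. -/
theorem exists_injective_natDegree_of_finrank_eq {F : Type*} [Field F] {m s : ℕ}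
    (W : Submodule F F[X]) (hWm : W ≤ degreeLT F m) (hW : finrank F W = s) :
    ∃ f : Fin s → F[X], (∀ i, f i ∈ W) ∧ (∀ i, f i ≠ 0) ∧
      Function.Injective fun i => (f i).natDegree := by
  classical
  let D : Finset ℕ := (Finset.range m).filter fun d => ∃ f ∈ W, f ≠ 0 ∧ f.natDegree = d
  let φ : W →ₗ[F] (D → F) := LinearMap.pi fun d => (lcoeff F d).comp W.subtype
  -- A nonzero element of `W` has its leading coefficient among those read by `φ`.
  have hφ : Function.Injective φ := by
    rw [injective_iff_map_eq_zero]
    rintro ⟨f, hf⟩ h0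
    by_contra hne
    have hf0 : f ≠ 0 := fun h => hne (by simpa using h)
    have hd : f.natDegree ∈ D := by
      refine Finset.mem_filter.2 ⟨Finset.mem_range.2 ?_, f, hf, hf0, rfl⟩
      exact (natDegree_lt_iff_degree_lt hf0).2 (mem_degreeLT.1 (hWm hf))
    have h1 : f.coeff f.natDegree = 0 := congrFun h0 ⟨_, hd⟩
    exact hf0 (leadingCoeff_eq_zero.1 h1)
  have hcard : s ≤ D.card := by
    have := LinearMap.finrank_le_finrank_of_injective hφ
    simpa [hW] using this
  have hD : ∀ d : D, ∃ f ∈ W, f ≠ 0 ∧ f.natDegree = d := fun d => (Finset.mem_filter.1 d.2).2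
  choose f hfW hf0 hfd using hD
  let e : Fin s → D := fun i => D.equivFin.symm (Fin.castLE hcard i)
  refine ⟨fun i => f (e i), fun i => hfW _, fun i => hf0 _, fun i j hij => ?_⟩
  have h1 : ((e i : D) : ℕ) = e j := by simpa only [hfd] using hij
  exact Fin.castLE_injective hcard (D.equivFin.symm.injective (Subtype.ext h1))

/-- The multiplicity of a root of the determinant of a polynomial matrix is at least the dimension
of the kernel of the evaluated matrix. -/
theorem pow_finrank_dvd_det {F : Type*} [Field F] {n : Type*} [Fintype n] [DecidableEq n]
    (M : Matrix n n F[X]) (p : F[X]) (K : Submodule F (n → F))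
    (hK : ∀ v ∈ K, ∀ j, p ∣ ∑ i, M j i * C (v i)) : p ^ finrank F K ∣ M.det := by
  classical
  obtain ⟨L, hL⟩ := K.exists_isCompl
  let b₀ := ((finBasis F K).prod (finBasis F L)).map (K.prodEquivOfIsCompl L hL)
  have hc : Fintype.card (Fin (finrank F K) ⊕ Fin (finrank F L)) = Fintype.card n := by
    rw [← finrank_eq_card_basis b₀, finrank_fintype_fun_eq_card]
  let e := Fintype.equivOfCardEq hc
  let b := b₀.reindex e
  have hb : ∀ k, b (e (Sum.inl k)) ∈ K := fun k => by
    simp [b, b₀]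
  let Q : Matrix n n F := (Pi.basisFun F n).toMatrix b
  have hQ : IsUnit Q.det := (Pi.basisFun F n).isUnit_det b
  -- In a basis extending one of `K`, the columns indexed by `K` are divisible by `p`.
  let u : n → F[X] := fun i => Sum.elim (fun _ => p) (fun _ => 1) (e.symm i)
  have hu : ∀ i j, u i ∣ (M * Q.map C) j i := by
    intro i j
    have hMQ : (M * Q.map C) j i = ∑ l, M j l * C (b i l) := by
      simp [Matrix.mul_apply, Q, Module.Basis.toMatrix_apply]
    rw [hMQ]
    obtain ⟨k, rfl⟩ := e.surjective i
    rcases k with k | k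
    · simpa [u] using hK _ (hb k) j
    · simp [u]
  choose N hN using hu
  have h1 : M * Q.map C = Matrix.of fun j i => u i * N i j := by
    ext1 j i
    exact hN i j
  have h2 : M.det * C Q.det = (∏ i, u i) * Matrix.det (fun j i => N i j) := by
    have h5 : (Q.map C).det = C Q.det := (RingHom.map_det C Q).symm
    rw [← h5, ← Matrix.det_mul, h1]
    exact Matrix.det_mul_row u fun j i => N i j
  have h3 : ∏ i, u i = p ^ finrank F K := by
    rw [← e.prod_comp]
    simp [u]
  have h4 : p ^ finrank F K ∣ M.det * C Q.det := by
    rw [h2, h3]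
    exact dvd_mul_right _ _
  exact (hQ.map C).dvd_mul_right.1 h4

theorem finrank_comap_of_injective {F V U : Type*} [Field F] [AddCommGroup V] [Module F V]
    [AddCommGroup U] [Module F U] (φ : V →ₗ[F] U) (hφ : Function.Injective φ)
    (N : Submodule F U) :
    finrank F (N.comap φ) = finrank F (LinearMap.range φ ⊓ N : Submodule F U) := by
  rw [← Submodule.map_comap_eq]
  exact (Submodule.equivMapOfInjective φ hφ _).finrank_eq

/-- The polynomials divisible by `g`. -/
noncomputable def multiplesOf {F : Type*} [Field F] (g : F[X]) : Submodule F F[X] :=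
  LinearMap.range (LinearMap.mulLeft F g)

theorem mem_multiplesOf {F : Type*} [Field F] {g f : F[X]} : f ∈ multiplesOf g ↔ g ∣ f := by
  simp only [multiplesOf, LinearMap.mem_range, LinearMap.mulLeft_apply, dvd_def, eq_comm]

theorem finrank_degreeLT (F : Type*) [Field F] (n : ℕ) : finrank F (degreeLT F n) = n := by
  simpa using (degreeLTEquiv F n).finrank_eq

theorem finrank_degreeLT_inf_multiplesOf {F : Type*} [Field F] {g : F[X]} (hg : g.Monic)
    {r s : ℕ} (hs : g.natDegree = s) :
    finrank F (degreeLT F (r + s) ⊓ multiplesOf g : Submodule F F[X]) = r := by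
  have h : (degreeLT F (r + s) ⊓ multiplesOf g : Submodule F F[X]) =
      (degreeLT F r).map (LinearMap.mulLeft F g) := by
    ext f
    simp only [Submodule.mem_inf, mem_multiplesOf, Submodule.mem_map, LinearMap.mulLeft_apply,
      mem_degreeLT]
    have key : ∀ q : F[X], (g * q).degree < ((r + s : ℕ) : WithBot ℕ) ↔ q.degree < r := by
      intro q
      rcases eq_or_ne q 0 with rfl | hq
      · simp
      · rw [← natDegree_lt_iff_degree_lt (mul_ne_zero hg.ne_zero hq),
          ← natDegree_lt_iff_degree_lt hq, hg.natDegree_mul' hq, hs]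
        omega
    constructor
    · rintro ⟨h1, q, rfl⟩
      exact ⟨q, (key q).1 h1, rfl⟩
    · rintro ⟨q, h1, rfl⟩
      exact ⟨(key q).2 h1, dvd_mul_right _ _⟩
  rw [h, ← (Submodule.equivMapOfInjective (LinearMap.mulLeft F g)
    (mul_right_injective₀ hg.ne_zero) _).finrank_eq, finrank_degreeLT]

/-! ### Degrees of polynomial determinants -/

theorem coeff_prod_sum_of_natDegree_le {R ι : Type*} [CommRing R] (S : Finset ι)
    (f : ι → R[X]) (d : ι → ℕ) (h : ∀ i ∈ S, (f i).natDegree ≤ d i) :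
    (∏ i ∈ S, f i).coeff (∑ i ∈ S, d i) = ∏ i ∈ S, (f i).coeff (d i) := by
  classical
  induction S using Finset.induction_on with
  | empty => simp
  | insert a S ha ih =>
    rw [Finset.forall_mem_insert] at h
    rw [Finset.prod_insert ha, Finset.sum_insert ha, Finset.prod_insert ha, ← ih h.2]
    exact coeff_mul_add_eq_of_natDegree_le h.1
      ((natDegree_prod_le _ _).trans (Finset.sum_le_sum h.2))

theorem Matrix.natDegree_det_le_sum {R n : Type*} [CommRing R] [Fintype n] [DecidableEq n]
    (M : Matrix n n R[X]) (d : n → ℕ) (h : ∀ j i, (M j i).natDegree ≤ d i) :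
    M.det.natDegree ≤ ∑ i, d i := by
  rw [Matrix.det_apply]
  refine natDegree_sum_le_of_forall_le _ _ fun σ _ => ?_
  refine (natDegree_smul_le _ _).trans ((natDegree_prod_le _ _).trans ?_)
  exact Finset.sum_le_sum fun i _ => h _ _

/-- Every term of the Leibniz expansion uses each column once, so the top coefficients can be
extracted column by column. -/
theorem Matrix.coeff_det_sum {R n : Type*} [CommRing R] [Fintype n] [DecidableEq n]
    (M : Matrix n n R[X]) (d : n → ℕ) (h : ∀ j i, (M j i).natDegree ≤ d i) :
    M.det.coeff (∑ i, d i) = (Matrix.of fun j i => (M j i).coeff (d i)).det := by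
  rw [Matrix.det_apply, Matrix.det_apply, finsetSum_coeff]
  refine Finset.sum_congr rfl fun σ _ => ?_
  rw [coeff_smul, coeff_prod_sum_of_natDegree_le _ _ _ fun i _ => h _ _]
  rfl

/-- The extremal set is {r, ..., r + |S| - 1}; removing the maximum gives the induction. -/
theorem Finset.sum_le_of_forall_lt (r : ℕ) (S : Finset ℕ) (hlt : ∀ x ∈ S, x < r + S.card) :
    ∑ x ∈ S, x ≤ r * S.card + S.card.choose 2 := by
  induction S using Finset.induction_on_max with
  | empty => simp
  | insert a S hS ih =>
    have ha : a ∉ S := fun h => (hS a h).false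
    rw [Finset.card_insert_of_notMem ha] at hlt ⊢
    rw [Finset.sum_insert ha, Nat.choose_succ_succ' S.card 1, Nat.choose_one_right]
    have h1 := hlt a (Finset.mem_insert_self a S)
    have h2 := ih fun x hx => by
      have := hS x hx
      omega
    nlinarith

theorem sum_le_of_injective_of_lt {r s : ℕ} (d : Fin s → ℕ) (hd : Function.Injective d)
    (hlt : ∀ i, d i < r + s) : ∑ i, d i ≤ r * s + s.choose 2 := by
  have h := Finset.sum_le_of_forall_lt r (Finset.univ.image d)
  rw [Finset.card_image_of_injective _ hd, Finset.sum_image fun _ _ _ _ h => hd h] at h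
  simpa using h (by simpa using hlt)


/-! ### The determinantal criterion and duality -/

/-- A determinantal criterion: if the operators `D j` send multiples of
`∏ k < s, (X - a k * t)` to multiples of `X - t`, and the determinants `det (D j (f i))` do not
vanish on families of distinct degrees and have degree at most `A`, then the multiples of these
polynomials form a strong design. -/
theorem exists_design_of_natDegree_det_le {F : Type*} [Field F] {r s A : ℕ} (hr : 1 ≤ r)
    (a : ℕ → F) (ha : ∑ k ∈ Finset.range s, a k ≠ 0) (D : Fin s → F[X] →ₗ[F] F[X])
    (hD : ∀ t f, ∏ k ∈ Finset.range s, (X - C (a k * t)) ∣ f → ∀ j, X - C t ∣ D j f)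
    (hdet : ∀ f : Fin s → F[X], (∀ i, f i ≠ 0) → (Function.Injective fun i => (f i).natDegree) →
      (∀ i, (f i).natDegree < r + s) → (Matrix.of fun j i => D j (f i)).det ≠ 0 ∧
        (Matrix.of fun j i => D j (f i)).det.natDegree ≤ A) :
    ∃ H : F → Submodule F (Fin (r + s) → F), Function.Injective H ∧
      IsUniformStrongSubspaceDesign r s A H := by
  classical
  let g : F → F[X] := fun t => ∏ k ∈ Finset.range s, (X - C (a k * t))
  have hgm : ∀ t, (g t).Monic := fun t => monic_prod_of_monic _ _ fun k _ => monic_X_sub_C _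
  have hgd : ∀ t, (g t).natDegree = s := fun t => by
    rw [natDegree_prod_of_monic _ _ fun k _ => monic_X_sub_C (a k * t)]
    simp only [natDegree_X_sub_C, Finset.sum_const, Finset.card_range, smul_eq_mul, mul_one]
  have hginj : Function.Injective g := by
    intro t u h
    -- The second coefficient of `g t` is -t ∑ a_k, which determines `t`.
    have h1 := congrArg nextCoeff h
    simp only [g, prod_X_sub_C_nextCoeff, ← Finset.sum_mul, neg_inj] at h1
    exact mul_left_cancel₀ ha h1
  let φ : (Fin (r + s) → F) →ₗ[F] F[X] :=
    (degreeLT F (r + s)).subtype ∘ₗ (degreeLTEquiv F (r + s)).symm.toLinearMap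
  have hφ : Function.Injective φ :=
    Subtype.val_injective.comp (degreeLTEquiv F (r + s)).symm.injective
  have hφr : LinearMap.range φ = degreeLT F (r + s) := by
    simp [φ, LinearMap.range_comp]
  refine ⟨fun t => (multiplesOf (g t)).comap φ, ?_, ?_, ?_⟩
  -- Since s < r + s, `g t` itself lies in its own space, so the space determines `g t`.
  · have key : ∀ t u, (multiplesOf (g t)).comap φ = (multiplesOf (g u)).comap φ → g u ∣ g t := by
      intro t u h
      have h1 : g t ∈ LinearMap.range φ := by
        rw [hφr, mem_degreeLT, ← natDegree_lt_iff_degree_lt (hgm t).ne_zero, hgd]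
        omega
      obtain ⟨v, hv⟩ := h1
      have h2 : v ∈ (multiplesOf (g t)).comap φ := by
        rw [Submodule.mem_comap, mem_multiplesOf, hv]
      rw [h, Submodule.mem_comap, mem_multiplesOf, hv] at h2
      exact h2
    intro t u h
    exact hginj (eq_of_monic_of_associated (hgm t) (hgm u)
      (associated_of_dvd_dvd (key u t h.symm) (key t u h)))
  · intro t
    rw [finrank_comap_of_injective φ hφ, hφr, finrank_degreeLT_inf_multiplesOf (hgm t) (hgd t)]
  · intro W hW T
    have hW' : finrank F (W.map φ) = s :=
      (Submodule.equivMapOfInjective φ hφ W).finrank_eq.symm.trans hW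
    have hWm : W.map φ ≤ degreeLT F (r + s) := by
      rw [← hφr]
      exact LinearMap.map_le_range
    obtain ⟨f, hfW, hf0, hfd⟩ := exists_injective_natDegree_of_finrank_eq _ hWm hW'
    obtain ⟨hP0, hPA⟩ := hdet f hf0 hfd fun i =>
      (natDegree_lt_iff_degree_lt (hf0 i)).2 (mem_degreeLT.1 (hWm (hfW i)))
    set M : Matrix (Fin s) (Fin s) F[X] := Matrix.of fun j i => D j (f i) with hM
    let Φ : (Fin s → F) →ₗ[F] F[X] := Fintype.linearCombination F f
    have hDΦ : ∀ v j, D j (Φ v) = ∑ i, M j i * C (v i) := by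
      intro v j
      simp only [Φ, Fintype.linearCombination_apply, map_sum, map_smul, hM, Matrix.of_apply]
      exact Finset.sum_congr rfl fun i _ => by rw [smul_eq_C_mul, mul_comm]
    -- A linear relation among the `f i` would be a constant kernel vector of `M`, whose determinant
    -- is nonzero.
    have hΦ : Function.Injective Φ := by
      rw [injective_iff_map_eq_zero]
      intro v hv
      have h1 : M.mulVec (fun i => C (v i)) = 0 := by
        ext1 j
        rw [Matrix.mulVec, dotProduct, ← hDΦ, hv]
        simp
      have h2 := Matrix.eq_zero_of_mulVec_eq_zero hP0 h1
      ext1 i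
      simpa using congrFun h2 i
    have hΦr : LinearMap.range Φ = W.map φ := by
      have : FiniteDimensional F (W.map φ) := inferInstance
      refine Submodule.eq_of_le_of_finrank_eq ?_ ?_
      · rintro _ ⟨v, rfl⟩
        rw [Fintype.linearCombination_apply]
        exact Submodule.sum_mem _ fun i _ => Submodule.smul_mem _ _ (hfW i)
      · rw [LinearMap.finrank_range_of_inj hΦ, hW']
        simp
    have hmap : ∀ N : Submodule F F[X], (W ⊓ N.comap φ).map φ = W.map φ ⊓ N := by
      intro N
      ext x
      simp only [Submodule.mem_map, Submodule.mem_inf, Submodule.mem_comap]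
      constructor
      · rintro ⟨v, ⟨hvW, hv⟩, rfl⟩
        exact ⟨⟨v, hvW, rfl⟩, hv⟩
      · rintro ⟨⟨v, hvW, rfl⟩, hv⟩
        exact ⟨v, ⟨hvW, hv⟩, rfl⟩
    have hrank : ∀ t, finrank F ((multiplesOf (g t)).comap φ ⊓ W : Submodule F _) =
        finrank F ((multiplesOf (g t)).comap Φ) := by
      intro t
      rw [finrank_comap_of_injective Φ hΦ, hΦr,
        inf_comm, ← hmap,
        (Submodule.equivMapOfInjective φ hφ _).finrank_eq]
    have hdvd : ∀ t, (X - C t) ^ finrank F ((multiplesOf (g t)).comap Φ) ∣ M.det := by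
      intro t
      refine pow_finrank_dvd_det M _ _ fun v hv j => ?_
      rw [← hDΦ]
      exact hD t _ (mem_multiplesOf.1 hv) j
    have hprod : ∏ t ∈ T, (X - C t) ^ finrank F ((multiplesOf (g t)).comap Φ) ∣ M.det := by
      refine Finset.prod_dvd_of_coprime (fun t _ u _ htu => ?_) fun t _ => hdvd t
      exact (pairwise_coprime_X_sub_C Function.injective_id htu).pow
    have hdeg := natDegree_le_of_dvd hprod hP0
    rw [natDegree_prod_of_monic _ _ fun t _ => (monic_X_sub_C t).pow _] at hdeg
    simp only [natDegree_pow, natDegree_X_sub_C, mul_one] at hdeg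
    simp only [hrank]
    exact hdeg.trans hPA

/-- Orthogonal complements turn an `r`-uniform strong `(s, A)` design in dimension `r + s` into an
`s`-uniform strong `(r, A)` design. -/
theorem exists_dual_design {F : Type*} [Field F] {ι : Type*} {r s m A : ℕ} (hm : m = r + s)
    (H : ι → Submodule F (Fin m → F)) (hinj : Function.Injective H)
    (hH : IsUniformStrongSubspaceDesign r s A H) :
    ∃ H' : ι → Submodule F (Fin m → F), Function.Injective H' ∧
      IsUniformStrongSubspaceDesign s r A H' := by
  let B : LinearMap.BilinForm F (Fin m → F) := Matrix.toBilin' 1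
  have hBn : B.Nondegenerate := 
    LinearMap.BilinForm.nondegenerate_toBilin'_of_det_ne_zero' _ (by simp)
  have hBr : B.IsRefl := by
    refine LinearMap.IsSymm.isRefl ⟨fun x y => ?_⟩
    simp [B, Matrix.toBilin'_apply', dotProduct_comm]
  have hoo : ∀ K, B.orthogonal (B.orthogonal K) = K :=
    LinearMap.BilinForm.orthogonal_orthogonal hBn hBr
  have hfr : ∀ K, finrank F (B.orthogonal K) = m - finrank F K := fun K => by
    simpa using LinearMap.BilinForm.finrank_orthogonal hBn K
  refine ⟨fun i => B.orthogonal (H i), fun i j h => hinj ?_, fun i => ?_, fun W hW T => ?_⟩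
  · rw [← hoo (H i), ← hoo (H j)]
    exact congrArg _ h
  · rw [hfr, hH.rank_eq]
    omega
  · have key : ∀ i, finrank F (B.orthogonal (H i) ⊓ W : Submodule F _) =
        finrank F (H i ⊓ B.orthogonal W : Submodule F _) := by
      intro i
      have h1 : B.orthogonal (H i) ⊓ W = B.orthogonal (H i ⊔ B.orthogonal W) := by
        conv_lhs => rw [← hoo W]
        ext x
        simp only [Submodule.mem_inf, LinearMap.BilinForm.mem_orthogonal_iff]
        constructor
        · rintro ⟨hx, hy⟩ z hz
          obtain ⟨u, hu, v, hv, rfl⟩ := Submodule.mem_sup.1 hz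
          have := hx u hu
          have := hy v hv
          simp_all
        · exact fun h => ⟨fun u hu => h u (Submodule.mem_sup_left hu),
            fun u hu => h u (Submodule.mem_sup_right hu)⟩
      have h2 := Submodule.finrank_sup_add_finrank_inf_eq (H i) (B.orthogonal W)
      have h3 : finrank F (H i ⊔ B.orthogonal W : Submodule F _) ≤ m := by
        simpa using Submodule.finrank_le (H i ⊔ B.orthogonal W)
      rw [h1, hfr]
      rw [hfr, hH.rank_eq, hW] at h2
      omega
    simp only [key]
    exact hH.sum_rank_le _ (by rw [hfr, hW]; omega) T

/-! ### The folded Wronskian and Wronskian designs -/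

theorem det_of_coeff_ne_zero {F : Type*} [Field F] {s : ℕ} (v : Fin s → F)
    (hv : Function.Injective v) (p : Fin s → F[X]) (hpd : ∀ j, (p j).natDegree = j)
    (hp : ∀ j, (p j).Monic) (l : Fin s → F) (hl : ∀ i, l i ≠ 0) :
    (Matrix.of fun j i => (p j).eval (v i) * l i).det ≠ 0 := by
  have h1 : (Matrix.of fun j i => (p j).eval (v i) * l i) =
      Matrix.of fun j i => l i * (Matrix.of fun i j => (p j).eval (v i)).transpose j i := by
    ext j i
    simp [mul_comm]
  rw [h1, Matrix.det_mul_row, Matrix.det_transpose,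
    ← Matrix.det_eval_matrixOfPolynomials_eq_det_vandermonde v p hpd hp]
  exact mul_ne_zero (Finset.prod_ne_zero_iff.2 fun i _ => hl i)
    (Matrix.det_vandermonde_ne_zero_iff.2 hv)

/-- The folded Wronskian design. -/
theorem exists_folded_design {F : Type*} [Field F] {r s : ℕ} (hr : 1 ≤ r) (hs : 1 ≤ s) (γ : F)
    (hγ : ∀ k, 0 < k → k < r + s → γ ^ k ≠ 1) (hγ0 : γ ≠ 0) :
    ∃ H : F → Submodule F (Fin (r + s) → F), Function.Injective H ∧
      IsUniformStrongSubspaceDesign r s (r * s + s.choose 2) H := by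
  have hinj : ∀ i j, i < r + s → j < r + s → γ ^ i = γ ^ j → i = j := by
    have : ∀ i j, i < j → j < r + s → γ ^ i ≠ γ ^ j := by
      intro i j hij hj h
      refine hγ (j - i) (by omega) (by omega) ?_
      rw [← mul_right_inj' (pow_ne_zero i hγ0), ← pow_add, mul_one, h]
      congr 1
      omega
    intro i j hi hj h
    by_contra hne
    rcases lt_or_gt_of_ne hne with hlt | hlt
    · exact this i j hlt hj h
    · exact this j i hlt hi h.symm
  refine exists_design_of_natDegree_det_le hr (fun k => γ ^ k) ?_
    (fun j => (aeval (C (γ ^ (j : ℕ)) * X : F[X])).toLinearMap) ?_ ?_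
  · intro h
    have h1 := geom_sum_mul γ s
    rw [h, zero_mul] at h1
    exact hγ s (by omega) (by omega) (sub_eq_zero.1 h1.symm)
  · rintro t _ ⟨q, rfl⟩ j
    rw [AlgHom.toLinearMap_apply, map_mul, map_prod]
    refine Dvd.dvd.mul_right ((Dvd.dvd.trans ?_ (Finset.dvd_prod_of_mem _
      (Finset.mem_range.2 j.2)))) _
    -- Substituting γ^j X turns the factor X - γ^j t into γ^j (X - t).
    refine ⟨C (γ ^ (j : ℕ)), ?_⟩
    simp
    ring
  · intro f hf0 hfd hfm
    have hc : ∀ (j i : Fin s) n, (aeval (C (γ ^ (j : ℕ)) * X : F[X]) (f i)).coeff n =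
        (f i).coeff n * (γ ^ (j : ℕ)) ^ n := by
      intro j i n
      exact comp_C_mul_X_coeff
    have hd : ∀ j i : Fin s, ((Matrix.of fun j i : Fin s =>
        (aeval (C (γ ^ (j : ℕ)) * X : F[X])).toLinearMap (f i)) j i).natDegree ≤
          (f i).natDegree := by
      intro j i
      refine natDegree_le_iff_coeff_eq_zero.2 fun n hn => ?_
      exact (hc j i n).trans (by rw [coeff_eq_zero_of_natDegree_lt hn, zero_mul])
    refine ⟨fun h => ?_, (Matrix.natDegree_det_le_sum _ _ hd).trans
      (sum_le_of_injective_of_lt _ hfd hfm)⟩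
    have h1 := Matrix.coeff_det_sum _ _ hd
    rw [h, coeff_zero] at h1
    -- The coefficient of degree ∑ deg f_i is a Vandermonde determinant in the γ^(deg f_i), times
    -- the leading coefficients.
    refine det_of_coeff_ne_zero (fun i => γ ^ (f i).natDegree)
      (fun i j hij => hfd (hinj _ _ (hfm i) (hfm j) hij)) (fun j => X ^ (j : ℕ))
      (fun j => natDegree_X_pow _) (fun j => monic_X_pow _) (fun i => (f i).leadingCoeff)
      (fun i => leadingCoeff_ne_zero.2 (hf0 i)) (Eq.trans ?_ h1.symm)
    congr 1
    ext j i
    refine Eq.trans ?_ (hc j i _).symm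
    simp [← pow_mul, mul_comm]

/-- The Wronskian design. -/
theorem exists_wronskian_design {F : Type*} [Field F] {r s : ℕ} (hr : 1 ≤ r) (hs : 1 ≤ s)
    (hF : ∀ k : ℕ, 0 < k → k < r + s → (k : F) ≠ 0) :
    ∃ H : F → Submodule F (Fin (r + s) → F), Function.Injective H ∧
      IsUniformStrongSubspaceDesign r s (r * s) H := by
  have hinj : ∀ i j : ℕ, i < r + s → j < r + s → (i : F) = j → i = j := by
    have : ∀ i j : ℕ, i < j → j < r + s → (i : F) ≠ j := by
      intro i j hij hj h
      refine hF (j - i) (by omega) (by omega) ?_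
      rw [Nat.cast_sub hij.le, h, sub_self]
    intro i j hi hj h
    by_contra hne
    rcases lt_or_gt_of_ne hne with hlt | hlt
    · exact this i j hlt hj h
    · exact this j i hlt hi h.symm
  refine exists_design_of_natDegree_det_le hr (fun k => 1) ?_
    (fun j => (derivative ^ (j : ℕ) : Module.End F F[X])) ?_ ?_
  · simpa using hF s (by omega) (by omega)
  · intro t f hf j
    simp only [one_mul, Finset.prod_const, Finset.card_range] at hf
    rw [Module.End.pow_apply]
    exact (dvd_pow_self _ (Nat.sub_ne_zero_of_lt j.2)).trans
      (pow_sub_dvd_iterate_derivative_of_pow_dvd _ hf)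
  · intro f hf0 hfd hfm
    set M : Matrix (Fin s) (Fin s) F[X] :=
      Matrix.of fun j i => (derivative ^ (j : ℕ) : Module.End F F[X]) (f i) with hM
    -- Scaling row j by X^j undoes the degree drop of the j-th derivative: column i now has degree
    -- at most deg f_i, and its coefficients there are falling factorials of deg f_i times the
    -- leading coefficient.
    set N : Matrix (Fin s) (Fin s) F[X] := Matrix.of fun j i => X ^ (j : ℕ) * M j i with hN
    have hNM : N.det = X ^ s.choose 2 * M.det := by
      rw [hN, Matrix.det_mul_column, Finset.prod_pow_eq_pow_sum, Fin.sum_univ_eq_sum_range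
        (fun i => i), Finset.sum_range_id, Nat.choose_two_right]
    have hc : ∀ (j i : Fin s) n, (N j i).coeff n = (n.descFactorial j : F) * (f i).coeff n := by
      intro j i n
      simp only [hN, hM, Matrix.of_apply, Module.End.pow_apply, coeff_X_pow_mul']
      split_ifs with h
      · rw [coeff_iterate_derivative, Nat.sub_add_cancel h, nsmul_eq_mul]
      · rw [Nat.descFactorial_eq_zero_iff_lt.2 (not_le.1 h)]
        simp
    have hd : ∀ j i : Fin s, (N j i).natDegree ≤ (f i).natDegree := by
      intro j i
      refine natDegree_le_iff_coeff_eq_zero.2 fun n hn => ?_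
      rw [hc, coeff_eq_zero_of_natDegree_lt hn, mul_zero]
    have hN0 : N.det ≠ 0 := by
      intro h
      have h1 := Matrix.coeff_det_sum _ _ hd
      rw [h, coeff_zero] at h1
      refine det_of_coeff_ne_zero (fun i => ((f i).natDegree : F))
        (fun i j hij => hfd (hinj _ _ (hfm i) (hfm j) hij)) (fun j => descPochhammer F j)
        (fun j => descPochhammer_natDegree F _) (fun j => monic_descPochhammer F _)
        (fun i => (f i).leadingCoeff)
        (fun i => leadingCoeff_ne_zero.2 (hf0 i)) (Eq.trans ?_ h1.symm)
      congr 1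
      ext j i
      simp only [Matrix.of_apply, hc, descPochhammer_eval_eq_descFactorial, leadingCoeff]
    have hM0 : M.det ≠ 0 := fun h => hN0 (by rw [hNM, h, mul_zero])
    refine ⟨hM0, ?_⟩
    -- The factor X^C(s,2) in `hNM` cancels the binomial term of the degree bound.
    have h2 := (Matrix.natDegree_det_le_sum _ _ hd).trans (sum_le_of_injective_of_lt _ hfd hfm)
    rw [hNM, natDegree_mul (pow_ne_zero _ X_ne_zero) hM0, natDegree_X_pow] at h2
    omega

/-! ### Choice of γ and conclusion -/

/-- A field with more than `n` elements has a nonzero element whose powers with positive exponent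
below `n` differ from one. -/
theorem exists_forall_pow_ne_one {F : Type*} [Field F] {n : ℕ} (hn : (n : ℕ∞) < ENat.card F) :
    ∃ γ : F, γ ≠ 0 ∧ ∀ k, 0 < k → k < n → γ ^ k ≠ 1 := by
  classical
  rcases finite_or_infinite F with hF | hF
  -- A generator of the unit group has order |F| - 1 ≥ n.
  · obtain ⟨g, hg⟩ := IsCyclic.exists_generator (α := Fˣ)
    refine ⟨g, g.ne_zero, fun k hk hkn h => ?_⟩
    have h1 : orderOf g ∣ k := orderOf_dvd_of_pow_eq_one (Units.ext (by simpa using h))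
    rw [orderOf_eq_card_of_forall_mem_zpowers hg, Nat.card_units] at h1
    have h2 := Nat.le_of_dvd hk h1
    rw [ENat.card_eq_coe_natCard, Nat.cast_lt] at hn
    omega
  · let p : F[X] := X * ∏ k ∈ Finset.Ioo 0 n, (X ^ k - 1)
    have hp : p ≠ 0 := mul_ne_zero X_ne_zero (Finset.prod_ne_zero_iff.2 fun k hk =>
      X_pow_sub_C_ne_zero (Finset.mem_Ioo.1 hk).1 (1 : F))
    obtain ⟨γ, hγ⟩ : ∃ γ, p.eval γ ≠ 0 := by
      by_contra! h
      exact hp (Polynomial.funext fun x => by simpa using h x)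
    simp only [p, eval_mul, eval_X, eval_prod, mul_ne_zero_iff, Finset.prod_ne_zero_iff] at hγ
    refine ⟨γ, hγ.1, fun k hk hkn h => hγ.2 k (Finset.mem_Ioo.2 ⟨hk, hkn⟩) ?_⟩
    simp [h]

theorem mainTheorem11 {F : Type*} [Field F] (r s : ℕ) (hr : 2 ≤ r) (hs : 2 ≤ s) :
    (((r + s : ℕ) : ℕ∞) < ENat.card F →
      ∃ H : F → Submodule F (Fin (r + s) → F), Function.Injective H ∧
        IsUniformStrongSubspaceDesign r s (r * s + min (Nat.choose s 2) (Nat.choose r 2)) H) ∧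
    ((ringChar F = 0 ∨ r + s < ringChar F) →
      ∃ H : F → Submodule F (Fin (r + s) → F), Function.Injective H ∧
        IsUniformStrongSubspaceDesign r s (r * s) H) := by
  constructor
  · intro hF
    obtain ⟨γ, hγ0, hγ⟩ := exists_forall_pow_ne_one hF
    rcases le_total (s.choose 2) (r.choose 2) with h | h
    · rw [min_eq_left h]
      exact exists_folded_design (by omega) (by omega) γ hγ hγ0
    -- When C(r,2) is smaller, dualize the folded design with r and s exchanged.
    · rw [min_eq_right h, mul_comm r s, add_comm r s]
      rw [add_comm r s] at hγ
      obtain ⟨H, hH, hd⟩ := exists_folded_design (r := s) (s := r) (by omega) (by omega) γ hγ hγ0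
      exact exists_dual_design rfl H hH hd
  · intro hF
    refine exists_wronskian_design (by omega) (by omega) fun k hk hkn h => ?_
    rw [ringChar.spec] at h
    rcases hF with h0 | h0
    · rw [h0, zero_dvd_iff] at h
      omega
    · exact absurd (Nat.le_of_dvd hk h) (by omega)
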